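/- Let $n\ge 2$, $d\ge 1$, $\alpha\in[\frac1{n+1},1]$ and $\epsilon\ge 0$. A regression algorithm $\mathcal A$ maps every data set of points of $\mathbb R^d\times\mathbb R$, of any size $m\ge1$, to a function $\mathbb R^d\to\mathbb R$ (the fitted value being jointly measurable in the data set and the evaluation point), and is invariant to reordering the data set. Given training points $(X_1,Y_1),\dots,(X_n,Y_n)$, let $\hat\mu$ be the function that $\mathcal A$ fits to all of them, $\hat\mu_{-i}$ the function that it fits to all but the $i$th, and $R_i=|Y_i-\hat\mu_{-i}(X_i)|$. For real $v_1,\dots,v_n$ let $\hat q^{+}\{v_i\}$ be the $\lceil(1-\alpha)(n+1)\rceil$-th smallest and $\hat q^{-}\{v_i\}$ the $\lfloor\alpha(n+1)\rfloor$-th smallest of these values, where the $k$-th smallest value means $-\infty$ if $k=0$ and $+\infty$ if $k>n$. The $\epsilon$-inflated naive, jackknife and jackknife+ prediction intervals are $$\hat C^{\mathrm{naive},\epsilon}(x)=\hat\mu(x)\pm\big(\hat q^{+}\{|Y_i-\hat\mu(X_i)|\}+\epsilon\big),\qquad \hat C^{\mathrm{jackknife},\epsilon}(x)=\hat\mu(x)\pm\big(\hat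 q^{+}\{R_i\}+\epsilon\big),$$ $$\hat C^{\mathrm{jackknife+},\epsilon}(x)=\big[\hat q^{-}\{\hat\mu_{-i}(x)-R_i\}-\epsilon,\ \hat q^{+}\{\hat\mu_{-i}(x)+R_i\}+\epsilon\big];$$ for $\epsilon=0$ these are the naive, jackknife and jackknife+ intervals themselves. Let $(X_1,Y_1),\dots,(X_{n+1},Y_{n+1})$ be drawn i.i.d. from a distribution $P$ on $\mathbb R^d\times\mathbb R$. Then there exist a distribution $P$ and a regression algorithm $\mathcal A$ (which may depend on $n,\alpha,d,\epsilon$) such that $$\mathbb P\big(Y_{n+1}\in\hat C^{\mathrm{naive},\epsilon}(X_{n+1})\big)=\mathbb P\big(Y_{n+1}\in\hat C^{\mathrm{jackknife},\epsilon}(X_{n+1})\big)=0.$$ If moreover $\alpha\le\frac12$, then there exist a distribution $P$ and a regression algorithm $\mathcal A$ such that $$\mathbb P\big(Y_{n+1}\in\hat C^{\mathrm{jackknife+},\epsilon}(X_{n+1})\big)\le 1-2\alpha+6\sqrt{\frac{\log n}{n}}.$$ -/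

import Mathlib

open MeasureTheory

noncomputable section

namespace Jackknife

/-- A data point `(x, y)` with feature vector `x ∈ ℝ^d` and response `y ∈ ℝ`. -/
abbrev Point (d : ℕ) : Type := (Fin d → ℝ) × ℝ

/-- A regression algorithm: it maps a training set of any size to a fitted function
`ℝ^d → ℝ`, and it is invariant to reordering the training set. -/
structure RegressionAlgorithm (d : ℕ) where
  /-- the function fitted on a training set of size `m` -/
  fit : (m : ℕ) → (Fin m → Point d) → (Fin d → ℝ) → ℝ
  symm : ∀ (m : ℕ) (D : Fin m → Point d) (π : Equiv.Perm (Fin m)),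
    fit m (fun i => D (π i)) = fit m D

/-- The fitted value depends measurably on the training set and the evaluation point jointly. -/
def RegressionAlgorithm.IsMeasurable {d : ℕ} (A : RegressionAlgorithm d) : Prop :=
  ∀ m : ℕ, Measurable fun z : (Fin m → Point d) × (Fin d → ℝ) => A.fit m z.1 z.2

/-- The `k`-th smallest of the values `v 0, …, v (n - 1)` (counted with multiplicity): the least `t`
such that at least `k` of the values are at most `t`. It is `+∞` if `k > n` and `-∞` if `k = 0`. -/
def kthSmallest {n : ℕ} (v : Fin n → ℝ) (k : ℕ) : EReal :=
  sInf {t : EReal | k ≤ (Finset.univ.filter fun i : Fin n => (v i : EReal) ≤ t).card}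

/-- The upper quantile `q⁺_{n,α}`: the `⌈(1 - α)(n + 1)⌉`-th smallest value. -/
def qPlus {n : ℕ} (α : ℝ) (v : Fin n → ℝ) : EReal :=
  kthSmallest v ⌈(1 - α) * ((n : ℝ) + 1)⌉₊

/-- The lower quantile `q⁻_{n,α}`: the `⌊α(n + 1)⌋`-th smallest value. -/
def qMinus {n : ℕ} (α : ℝ) (v : Fin n → ℝ) : EReal :=
  kthSmallest v ⌊α * ((n : ℝ) + 1)⌋₊

/-- The data set with the `i`-th point removed. -/
def leaveOneOut {β : Type} {n : ℕ} (D : Fin n → β) (i : Fin n) : Fin (n - 1) → β :=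
  fun j => if j.val < i.val then D ⟨j.val, by omega⟩ else D ⟨j.val + 1, by omega⟩

variable {d n : ℕ}

/-- The function fitted on the full training set. -/
def muHat (A : RegressionAlgorithm d) (D : Fin n → Point d) : (Fin d → ℝ) → ℝ :=
  A.fit n D

/-- The function fitted on the training set with the `i`-th point removed. -/
def muHatLOO (A : RegressionAlgorithm d) (D : Fin n → Point d) (i : Fin n) : (Fin d → ℝ) → ℝ :=
  A.fit (n - 1) (leaveOneOut D i)

/-- The in-sample residual `|Y_i - μ̂(X_i)|`. -/
def residual (A : RegressionAlgorithm d) (D : Fin n → Point d) (i : Fin n) : ℝ :=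
  |(D i).2 - muHat A D (D i).1|

/-- The leave-one-out residual `|Y_i - μ̂_{-i}(X_i)|`. -/
def residualLOO (A : RegressionAlgorithm d) (D : Fin n → Point d) (i : Fin n) : ℝ :=
  |(D i).2 - muHatLOO A D i (D i).1|

/-- The set of reals in the closed interval with extended real end points `lo` and `hi`. -/
def interval (lo hi : EReal) : Set ℝ := {y : ℝ | lo ≤ (y : EReal) ∧ (y : EReal) ≤ hi}

/-- The `ε`-inflated naive interval `μ̂(x) ± (q⁺{|Y_i - μ̂(X_i)|} + ε)`;
the naive interval itself is the case `ε = 0`. -/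
def naiveInterval (ε α : ℝ) (A : RegressionAlgorithm d) (D : Fin n → Point d)
    (x : Fin d → ℝ) : Set ℝ :=
  interval ((muHat A D x : EReal) - (qPlus α (residual A D) + (ε : EReal)))
    ((muHat A D x : EReal) + (qPlus α (residual A D) + (ε : EReal)))

/-- The `ε`-inflated jackknife interval `μ̂(x) ± (q⁺{R_i} + ε)`, with the leave-one-out residuals
`R_i`; the jackknife interval itself is the case `ε = 0`. -/
def jackknifeInterval (ε α : ℝ) (A : RegressionAlgorithm d) (D : Fin n → Point d)
    (x : Fin d → ℝ) : Set ℝ :=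
  interval ((muHat A D x : EReal) - (qPlus α (residualLOO A D) + (ε : EReal)))
    ((muHat A D x : EReal) + (qPlus α (residualLOO A D) + (ε : EReal)))

/-- The `ε`-inflated jackknife+ interval
`[q⁻{μ̂_{-i}(x) - R_i} - ε, q⁺{μ̂_{-i}(x) + R_i} + ε]`;
the jackknife+ interval itself is the case `ε = 0`. -/
def jackknifePlusInterval (ε α : ℝ) (A : RegressionAlgorithm d) (D : Fin n → Point d)
    (x : Fin d → ℝ) : Set ℝ :=
  interval (qMinus α (fun i => muHatLOO A D i x - residualLOO A D i) - (ε : EReal))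
    (qPlus α (fun i => muHatLOO A D i x + residualLOO A D i) + (ε : EReal))

/-- The predictive coverage `ℙ(Y_{n+1} ∈ C(X_{n+1}))` of an interval construction `C`, which takes
a training set of size `n` and a test feature vector, when the `n` training points and the test
point are drawn i.i.d. from `P`. -/
def coverage (n : ℕ) (P : ProbabilityMeasure (Point d))
    (C : (Fin n → Point d) → (Fin d → ℝ) → Set ℝ) : ℝ :=
  ((Measure.pi fun _ : Fin n => (P : Measure (Point d))).prod (P : Measure (Point d))).real
    {z | z.2.2 ∈ C z.1 z.2.1}

end Jackknife

end

noncomputable section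

namespace Jackknife

open ProbabilityTheory

/-! ### Quantiles -/

/-! All responses are `0` and the first feature is uniform on `[-1/2, 1/2]`. For the naive and
jackknife intervals, `overfit` interpolates the data at size `n` and fits `0` at size `n - 1`, so
both kinds of residual vanish. A test feature is almost surely new and gets the value `ε + 1`, so
the interval lies above `0` (`coverage_overfit`).

For jackknife+, `tournament` fits `-height`, so the `i`th upper value at `x` is `height z_i - height
x`, both with sign `g = τ * signOf z_i`, where `τ` is the product of all training signs
(`signProd_leaveOneOut`). Thus `x` is compared with `z_i` by absolute value, in opposite orders on
the two half-lines. For `|x| ≤ b`, the points that `x` fails to beat are those closer to `0` on one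
side and those between `|x|` and `b` on the other: total length about `b`, whatever `x` is
(`volume_unbeaten_le`). By Hoeffding, `x` beats about `n (1 - b)` points, enough to push the upper
end below `0` once `b` is slightly less than `α`. Coverage then fails with probability about `2b`.
-/

lemma kthSmallest_le {n k : ℕ} {v : Fin n → ℝ} {t : ℝ}
    (h : k ≤ (Finset.univ.filter fun i => v i ≤ t).card) : kthSmallest v k ≤ t := by
  refine sInf_le ?_
  simpa only [Set.mem_ofPred_eq, EReal.coe_le_coe_iff] using h

/-- The largest value below `t` is a strictly smaller threshold; if there is none, then `k = 0` and
any threshold works. -/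
lemma kthSmallest_lt {n k : ℕ} {v : Fin n → ℝ} {t : ℝ}
    (h : k ≤ (Finset.univ.filter fun i => v i < t).card) : kthSmallest v k < t := by
  rcases (Finset.univ.filter fun i => v i < t).eq_empty_or_nonempty with h0 | h0
  · refine (kthSmallest_le (t := t - 1) ?_).trans_lt (by exact_mod_cast sub_one_lt t)
    rw [h0, Finset.card_empty] at h
    exact h.trans (Nat.zero_le _)
  · obtain ⟨j, hj, hmax⟩ := Finset.exists_max_image _ v h0
    refine (kthSmallest_le (t := v j) (h.trans (Finset.card_le_card fun i hi => ?_))).trans_lt ?_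
    · simpa using hmax i hi
    · exact_mod_cast (Finset.mem_filter.1 hj).2

/-- This keeps the upper quantile from being `+∞`. -/
lemma ceil_quantile_le {n : ℕ} {α : ℝ} (hα : 1 / ((n : ℝ) + 1) ≤ α) :
    ⌈(1 - α) * ((n : ℝ) + 1)⌉₊ ≤ n := by
  rw [Nat.ceil_le]
  have := (div_le_iff₀ (by positivity)).1 hα
  linarith

/-! ### The distribution of the data -/

/-- The uniform distribution on `[-1/2, 1/2]`. -/
def centeredUniform : Measure ℝ := volume.restrict (Set.Icc (-1 / 2) (1 / 2))

instance : IsProbabilityMeasure centeredUniform :=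
  ⟨by simp [centeredUniform]; norm_num⟩

lemma centeredUniform_le (s : Set ℝ) : centeredUniform s ≤ volume s :=
  Measure.restrict_apply_le _ _

/-- The data point with all features equal to `z` and response `0`. -/
def diagPoint (d : ℕ) (z : ℝ) : Point d := (fun _ => z, 0)

lemma measurable_diagPoint (d : ℕ) : Measurable (diagPoint d) := by
  unfold diagPoint
  fun_prop

/-- All features equal and uniformly distributed, response `0`. -/
def diagDist (d : ℕ) : ProbabilityMeasure (Point d) :=
  ⟨centeredUniform.map (diagPoint d),
    Measure.isProbabilityMeasure_map (measurable_diagPoint d).aemeasurable⟩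

lemma diagDist_apply {d : ℕ} {s : Set ℝ} (hs : MeasurableSet s) :
    (diagDist (d + 1) : Measure (Point (d + 1))) {x | x.1 0 ∈ s} = centeredUniform s := by
  have h : Measurable fun x : Point (d + 1) => x.1 0 := by fun_prop
  exact Measure.map_apply (measurable_diagPoint _) (h hs)

lemma ae_response_eq_zero (d : ℕ) : ∀ᵐ x ∂(diagDist d : Measure (Point d)), x.2 = 0 := by
  have h : MeasurableSet {x : Point d | x.2 = 0} := measurable_snd (measurableSet_singleton 0)
  refine (ae_map_iff (measurable_diagPoint d).aemeasurable h).2 ?_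
  simp [diagPoint]

/-- The joint law of the training set and the test point. -/
abbrev jointLaw (d n : ℕ) : Measure ((Fin n → Point d) × Point d) :=
  (Measure.pi fun _ : Fin n => (diagDist d : Measure (Point d))).prod
    (diagDist d : Measure (Point d))

lemma ae_responses_eq_zero (d n : ℕ) :
    ∀ᵐ z ∂jointLaw d n, z.2.2 = 0 ∧ ∀ i, (z.1 i).2 = 0 := by
  refine (Measure.quasiMeasurePreserving_snd.ae (ae_response_eq_zero d)).and
    (ae_all_iff.2 fun i => ?_)
  exact Measure.quasiMeasurePreserving_fst.ae
    ((Measure.quasiMeasurePreserving_eval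
      (fun _ : Fin n => (diagDist d : Measure (Point d))) i).ae (ae_response_eq_zero d))

lemma ae_test_feature_ne (d n : ℕ) :
    ∀ᵐ z ∂jointLaw (d + 1) n, ∀ i, (z.1 i).1 0 ≠ z.2.1 0 := by
  refine ae_all_iff.2 fun i => ?_
  have hm : MeasurableSet {z : (Fin n → Point (d + 1)) × Point (d + 1) |
      (z.1 i).1 0 ≠ z.2.1 0} :=
    (measurableSet_eq_fun (by fun_prop) (by fun_prop)).compl
  refine (Measure.ae_prod_iff_ae_ae hm).2 (Filter.Eventually.of_forall fun D => ?_)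
  rw [ae_iff]
  have : {x : Point (d + 1) | ¬(D i).1 0 ≠ x.1 0} = {x | x.1 0 ∈ ({(D i).1 0} : Set ℝ)} := by
    ext x; simp [eq_comm]
  rw [this, diagDist_apply (measurableSet_singleton _)]
  exact le_antisymm ((centeredUniform_le _).trans (by simp)) (zero_le)

/-! ### The naive and the jackknife interval -/

/-- With training sets of size `n`, the algorithm fits `0` at the observed features and `c`
elsewhere; with training sets of any other size it fits `0` everywhere. -/
def overfit (d n : ℕ) (c : ℝ) : RegressionAlgorithm (d + 1) := by
  classical
  exact
    { fit := fun m D x => if m = n ∧ ∀ i, (D i).1 0 ≠ x 0 then c else 0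
      symm := fun m D π => by
        funext x
        congr 2
        exact propext (Equiv.forall_congr_left π (p := fun i => (D (π i)).1 0 ≠ x 0) |>.trans
          (by simp)) }

lemma overfit_isMeasurable (d n : ℕ) (c : ℝ) : (overfit d n c).IsMeasurable := by
  intro m
  refine Measurable.ite ?_ measurable_const measurable_const
  refine MeasurableSet.inter (MeasurableSet.const _) ?_
  have : {z : (Fin m → Point (d + 1)) × (Fin (d + 1) → ℝ) | ∀ i, (z.1 i).1 0 ≠ z.2 0}
      = ⋂ i, {z | (z.1 i).1 0 = z.2 0}ᶜ := by ext; simp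
  change MeasurableSet {z : (Fin m → Point (d + 1)) × (Fin (d + 1) → ℝ) |
    ∀ i, (z.1 i).1 0 ≠ z.2 0}
  rw [this]
  exact MeasurableSet.iInter fun i =>
    (measurableSet_eq_fun (by fun_prop) (by fun_prop)).compl

lemma overfit_residual {d n : ℕ} {c : ℝ} {D : Fin n → Point (d + 1)} (hD : ∀ i, (D i).2 = 0)
    (i : Fin n) : residual (overfit d n c) D i = 0 := by
  have h : muHat (overfit d n c) D (D i).1 = 0 :=
    if_neg fun h => h.2 i rfl
  simp [residual, h, hD]

lemma overfit_residualLOO {d n : ℕ} {c : ℝ} (hn : 1 ≤ n) {D : Fin n → Point (d + 1)}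
    (hD : ∀ i, (D i).2 = 0) (i : Fin n) : residualLOO (overfit d n c) D i = 0 := by
  have h : muHatLOO (overfit d n c) D i (D i).1 = 0 :=
    if_neg fun h => by omega
  simp [residualLOO, h, hD]

lemma zero_notMem_interval {n : ℕ} {α ε : ℝ} (hα : 1 / ((n : ℝ) + 1) ≤ α) {v : Fin n → ℝ}
    (hv : ∀ i, v i = 0) {hi : EReal} :
    (0 : ℝ) ∉ interval (((ε + 1 : ℝ) : EReal) - (qPlus α v + (ε : EReal))) hi := by
  rintro ⟨h, -⟩
  have hq : qPlus α v ≤ (0 : ℝ) := by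
    refine kthSmallest_le ?_
    simpa [hv] using ceil_quantile_le hα
  have h1 : qPlus α v + (ε : EReal) ≤ (ε : EReal) := by simpa using add_le_add_left hq (ε : EReal)
  have h2 := (EReal.sub_le_sub le_rfl h1).trans h
  rw [← EReal.coe_sub, EReal.coe_le_coe_iff] at h2
  linarith

lemma coverage_eq_zero_of_ae {d n : ℕ} {C : (Fin n → Point d) → (Fin d → ℝ) → Set ℝ}
    (h : ∀ᵐ z ∂jointLaw d n, z.2.2 ∉ C z.1 z.2.1) : coverage n (diagDist d) C = 0 := by
  have h0 : jointLaw d n {z | z.2.2 ∈ C z.1 z.2.1} = 0 := by simpa [ae_iff] using h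
  simp [coverage, Measure.real, h0]

lemma coverage_overfit {d n : ℕ} (hn : 1 ≤ n) {α : ℝ} (hα : 1 / ((n : ℝ) + 1) ≤ α) (ε : ℝ) :
    coverage n (diagDist (d + 1)) (naiveInterval ε α (overfit d n (ε + 1))) = 0 ∧
      coverage n (diagDist (d + 1)) (jackknifeInterval ε α (overfit d n (ε + 1))) = 0 := by
  constructor <;> refine coverage_eq_zero_of_ae ?_ <;>
    filter_upwards [ae_responses_eq_zero (d + 1) n, ae_test_feature_ne d n] with z hz hne <;>
    have hmu : muHat (overfit d n (ε + 1)) z.1 z.2.1 = ε + 1 := if_pos ⟨rfl, hne⟩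
  · rw [naiveInterval, hz.1, hmu]
    exact zero_notMem_interval hα (overfit_residual hz.2)
  · rw [jackknifeInterval, hz.1, hmu]
    exact zero_notMem_interval hα (overfit_residualLOO hn hz.2)

/-! ### Concentration of counts -/

/-- Hoeffding bound for the number of sample points that fall into a set of measure at most `q`. -/
lemma measureReal_card_ge_le {Ω : Type*} [MeasurableSpace Ω] (μ : Measure Ω)
    [IsProbabilityMeasure μ] {S : Set Ω} (hS : MeasurableSet S) {q : ℝ} (hq : μ.real S ≤ q)
    (n : ℕ) {t : ℝ} (ht : 0 ≤ t) :
    (Measure.pi fun _ : Fin n => μ).real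
        {D | n * q + t ≤ ∑ i, S.indicator (fun _ => (1 : ℝ)) (D i)} ≤
      Real.exp (-(2 * t ^ 2 / n)) := by
  set f : Ω → ℝ := S.indicator fun _ => 1 with hf
  have hfm : Measurable f := measurable_const.indicator hS
  have hint : ∫ x, f x ∂μ = μ.real S := integral_indicator_one hS
  have hind : iIndepFun (fun (i : Fin n) (D : Fin n → Ω) => f (D i) - ∫ x, f x ∂μ)
      (Measure.pi fun _ : Fin n => μ) :=
    iIndepFun_pi (X := fun _ x => f x - ∫ x, f x ∂μ) fun _ =>
      (hfm.sub_const _).aemeasurable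
  have hsub : ∀ i ∈ (Finset.univ : Finset (Fin n)),
      HasSubgaussianMGF (fun D : Fin n → Ω => f (D i) - ∫ x, f x ∂μ)
        ((‖(1 : ℝ) - 0‖₊ / 2) ^ 2) (Measure.pi fun _ : Fin n => μ) := by
    intro i _
    have hmp := measurePreserving_eval (fun _ : Fin n => μ) i
    have h := hasSubgaussianMGF_of_mem_Icc (μ := Measure.pi fun _ : Fin n => μ)
      (X := fun D => f (D i)) (a := 0) (b := 1)
      (hfm.comp (measurable_pi_apply i)).aemeasurable
      (Filter.Eventually.of_forall fun D => by
        by_cases h : D i ∈ S <;> simp [hf, h])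
    have he : ∫ D, f (D i) ∂(Measure.pi fun _ : Fin n => μ) = ∫ x, f x ∂μ := by
      conv_rhs => rw [← hmp.map_eq]
      exact (integral_map (measurable_pi_apply i).aemeasurable
        hfm.aestronglyMeasurable).symm
    simpa only [he] using h
  have key := HasSubgaussianMGF.measure_sum_ge_le_of_iIndepFun hind hsub ht
  refine (measureReal_mono fun D hD => ?_).trans (key.trans_eq ?_)
  · simp only [Set.mem_ofPred_eq, Finset.sum_sub_distrib, Finset.sum_const, Finset.card_univ,
      Fintype.card_fin, nsmul_eq_mul, hint] at hD ⊢
    have : (n : ℝ) * μ.real S ≤ n * q := by gcongr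
    linarith
  · congr 1
    rcases Nat.eq_zero_or_pos n with rfl | hn
    · simp
    · have : (0 : ℝ) < n := by exact_mod_cast hn
      simp
      field_simp

/-! ### The sign-dependent algorithm for jackknife+ -/

/-- `-1` for negative reals, `1` for the others. -/
def signOf (z : ℝ) : ℝ := if z < 0 then -1 else 1

lemma signOf_eq_or (z : ℝ) : signOf z = 1 ∨ signOf z = -1 := by
  unfold signOf; split_ifs <;> simp

lemma measurable_signOf : Measurable signOf :=
  Measurable.ite measurableSet_Iio measurable_const measurable_const

/-- The product of the signs of the first features. -/
def signProd {d m : ℕ} (D : Fin m → Point (d + 1)) : ℝ := ∏ i, signOf ((D i).1 0)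

lemma signProd_eq_or {d m : ℕ} (D : Fin m → Point (d + 1)) :
    signProd D = 1 ∨ signProd D = -1 := by
  unfold signProd
  refine Finset.prod_induction _ (fun x => x = 1 ∨ x = -1) ?_ (Or.inl rfl)
    fun i _ => signOf_eq_or _
  rintro a b (rfl | rfl) (rfl | rfl) <;> simp

lemma measurable_signProd (d m : ℕ) :
    Measurable (signProd : (Fin m → Point (d + 1)) → ℝ) :=
  Finset.measurable_fun_prod _ fun i _ => measurable_signOf.comp (by fun_prop)

lemma signProd_leaveOneOut {d n : ℕ} (D : Fin n → Point (d + 1)) (i : Fin n) :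
    signProd (leaveOneOut D i) = signProd D * signOf ((D i).1 0) := by
  obtain ⟨m, rfl⟩ : ∃ m, n = m + 1 := ⟨n - 1, by have := i.pos; omega⟩
  have h : leaveOneOut D i = fun j : Fin m => D (i.succAbove j) := by
    funext j
    by_cases hj : j.val < i.val
    · rw [Fin.succAbove_of_castSucc_lt _ _ hj]
      exact if_pos hj
    · rw [Fin.succAbove_of_le_castSucc _ _ (not_lt.1 hj)]
      exact if_neg hj
  have h1 : signOf ((D i).1 0) * signOf ((D i).1 0) = 1 := by
    rcases signOf_eq_or ((D i).1 0) with h | h <;> simp [h]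
  have h2 : signProd (leaveOneOut D i) = ∏ j : Fin m, signOf ((D (i.succAbove j)).1 0) :=
    congrArg signProd h
  rw [h2, signProd, Fin.prod_univ_succAbove _ i]
  linear_combination (-(∏ j : Fin m, signOf ((D (i.succAbove j)).1 0))) * h1

/-- The negative of a fitted value: inside `[-b, b]` it is monotone in `|z|`, increasing or
decreasing according to the sign `g`; outside it vanishes. -/
def height (b K c g z : ℝ) : ℝ := if |z| ≤ b then K * b + c + g * (K * |z|) else 0

lemma height_nonneg {b K c g z : ℝ} (hK : 0 ≤ K) (hc : 0 ≤ c) (hg : g = 1 ∨ g = -1) :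
    0 ≤ height b K c g z := by
  unfold height
  split_ifs with h
  · have h1 : K * |z| ≤ K * b := by gcongr
    have h2 : 0 ≤ K * |z| := by positivity
    rcases hg with rfl | rfl <;> linarith
  · exact le_rfl

/-- The regression algorithm with fitted values `-height`, the sign being read off from the
training set. -/
def tournament (d : ℕ) (b K c : ℝ) : RegressionAlgorithm (d + 1) where
  fit _ D x := -height b K c (signProd D) (x 0)
  symm m D π := by
    have : signProd (fun i => D (π i)) = signProd D :=
      Equiv.prod_comp π fun i => signOf ((D i).1 0)
    rw [this]

lemma tournament_isMeasurable (d : ℕ) (b K c : ℝ) : (tournament d b K c).IsMeasurable := by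
  intro m
  refine (Measurable.ite ?_ ?_ measurable_const).neg
  · exact measurableSet_le (by fun_prop) (by fun_prop)
  · have := (measurable_signProd d m).comp
      (measurable_fst : Measurable (Prod.fst : (Fin m → Point (d + 1)) × (Fin (d + 1) → ℝ) → _))
    have h2 : Measurable fun z : (Fin m → Point (d + 1)) × (Fin (d + 1) → ℝ) => |z.2 0| := by
      fun_prop
    exact (this.mul (h2.const_mul K)).const_add _

/-- The points that a point at distance `a` from the origin fails to beat by a margin `η`, when
the product of the training signs is `τ`. -/
def unbeaten (b η τ a : ℝ) : Set ℝ := {z | |z| ≤ b ∧ τ * signOf z * (a - |z|) ≤ η}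

/-- Slope `K` turns the margin `η` into at least `ε`; points outside `[-b, b]` have height `0`,
while inside it is at least `c > ε`. -/
lemma height_lt_of_notMem_unbeaten {b K c η τ x z ε : ℝ} (hK : 0 < K) (hη : ε ≤ K * η)
    (hc : ε < c) (hτ : τ = 1 ∨ τ = -1) (hx : |x| ≤ b) (hz : z ∉ unbeaten b η τ |x|) :
    height b K c (τ * signOf z) z + ε < height b K c (τ * signOf z) x := by
  rw [height, height, if_pos hx]
  split_ifs with h
  · have h1 : η < τ * signOf z * (|x| - |z|) := by
      by_contra h2
      exact hz ⟨h, not_lt.1 h2⟩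
    have h2 := mul_lt_mul_of_pos_left h1 hK
    linarith
  · have h1 : K * |x| ≤ K * b := by gcongr
    have h2 : 0 ≤ K * |x| := by positivity
    have hg : τ * signOf z = 1 ∨ τ * signOf z = -1 := by
      rcases hτ with rfl | rfl <;> rcases signOf_eq_or z with h | h <;> simp [h]
    rcases hg with hg | hg <;> rw [hg] <;> linarith

lemma measurableSet_unbeaten (b η τ a : ℝ) : MeasurableSet (unbeaten b η τ a) := by
  have h1 : Measurable fun z : ℝ => |z| := by fun_prop
  exact (measurableSet_le h1 measurable_const).inter
    (measurableSet_le ((measurable_signOf.const_mul τ).mul (h1.const_sub a)) measurable_const)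

/-- One half-line contributes length `a + η`, the other `b - a + η`; `a` cancels. -/
lemma volume_unbeaten_le {b η τ a : ℝ} (hη : 0 ≤ η) (hτ : τ = 1 ∨ τ = -1) (ha : 0 ≤ a)
    (hab : a ≤ b) : volume (unbeaten b η τ a) ≤ ENNReal.ofReal (b + 2 * η) := by
  have key : ∀ s t u v : ℝ, unbeaten b η τ a ⊆ Set.Icc s t ∪ Set.Icc u v →
      0 ≤ t - s → 0 ≤ v - u → t - s + (v - u) = b + 2 * η →
      volume (unbeaten b η τ a) ≤ ENNReal.ofReal (b + 2 * η) := by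
    intro s t u v hsub h1 h2 h3
    refine (measure_mono hsub).trans ((measure_union_le _ _).trans ?_)
    rw [Real.volume_Icc, Real.volume_Icc, ← ENNReal.ofReal_add h1 h2, h3]
  rcases hτ with rfl | rfl
  · refine key (-(a + η)) 0 (a - η) b (fun z hz => ?_) (by linarith) (by linarith) (by ring)
    obtain ⟨hz1, hz2⟩ := hz
    rcases lt_or_ge z 0 with h | h
    · rw [signOf, if_pos h, abs_of_neg h] at hz2
      exact Or.inl ⟨by linarith, h.le⟩
    · rw [signOf, if_neg h.not_gt, abs_of_nonneg h] at hz2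
      exact Or.inr ⟨by linarith, (le_abs_self z).trans hz1⟩
  · refine key (-b) (-(a - η)) 0 (a + η) (fun z hz => ?_) (by linarith) (by linarith) (by ring)
    obtain ⟨hz1, hz2⟩ := hz
    rcases lt_or_ge z 0 with h | h
    · rw [signOf, if_pos h, abs_of_neg h] at hz2
      exact Or.inl ⟨(abs_le.1 hz1).1, by linarith⟩
    · rw [signOf, if_neg h.not_gt, abs_of_nonneg h] at hz2
      exact Or.inr ⟨h, by linarith⟩

/-- The number of training points that a test point with first feature `x` fails to beat. -/
def unbeatenCount {d n : ℕ} (b η τ : ℝ) (D : Fin n → Point (d + 1)) (x : ℝ) : ℝ :=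
  ∑ i, (unbeaten b η τ |x|).indicator (fun _ => (1 : ℝ)) ((D i).1 0)

lemma qPlus_lt_of_unbeatenCount_lt {d n : ℕ} {α b K c η ε : ℝ} (hK : 0 < K) (hε : 0 ≤ ε)
    (hη : ε ≤ K * η) (hc : ε < c) {D : Fin n → Point (d + 1)} (hD : ∀ i, (D i).2 = 0)
    {x : Fin (d + 1) → ℝ} (hx : |x 0| ≤ b)
    (h : (⌈(1 - α) * ((n : ℝ) + 1)⌉₊ : ℝ) ≤ n - unbeatenCount b η (signProd D) D (x 0)) :
    qPlus α (fun i => muHatLOO (tournament d b K c) D i x +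
      residualLOO (tournament d b K c) D i) < ((-ε : ℝ) : EReal) := by
  classical
  refine kthSmallest_lt ?_
  rw [← Nat.cast_le (α := ℝ)]
  refine h.trans ?_
  have hcard : (n : ℝ) - unbeatenCount b η (signProd D) D (x 0) =
      ∑ i : Fin n, if (D i).1 0 ∉ unbeaten b η (signProd D) |x 0| then (1 : ℝ) else 0 := by
    have : (n : ℝ) = ∑ _i : Fin n, (1 : ℝ) := by simp
    rw [this, unbeatenCount, ← Finset.sum_sub_distrib]
    refine Finset.sum_congr rfl fun i _ => ?_
    by_cases hi : (D i).1 0 ∈ unbeaten b η (signProd D) |x 0| <;> simp [hi]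
  rw [hcard, Finset.sum_boole, Nat.cast_le]
  refine Finset.card_le_card fun i hi => ?_
  rw [Finset.mem_filter] at hi ⊢
  refine ⟨Finset.mem_univ _, ?_⟩
  have hlt := height_lt_of_notMem_unbeaten hK hη hc (signProd_eq_or D) hx hi.2
  rw [← signProd_leaveOneOut] at hlt
  have h0 : 0 ≤ height b K c (signProd (leaveOneOut D i)) ((D i).1 0) :=
    height_nonneg hK.le (by linarith) (signProd_eq_or _)
  simp only [muHatLOO, residualLOO, hD, tournament, zero_sub, neg_neg, abs_of_nonneg h0]
  linarith

/-! ### Coverage of jackknife+ and choice of constants -/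

lemma coverage_tournament_le {d n : ℕ} {α b K c η ε t : ℝ} (hb : 0 ≤ b) (hb1 : b ≤ 1 / 2)
    (hK : 0 < K) (hε : 0 ≤ ε) (hη0 : 0 ≤ η) (hη : ε ≤ K * η) (hc : ε < c) (ht : 0 ≤ t)
    (hk : (⌈(1 - α) * ((n : ℝ) + 1)⌉₊ : ℝ) ≤ n - (n * (b + 2 * η) + t)) :
    coverage n (diagDist (d + 1)) (jackknifePlusInterval ε α (tournament d b K c)) ≤
      1 - 2 * b + 2 * Real.exp (-(2 * t ^ 2 / n)) := by
  set far : Set ((Fin n → Point (d + 1)) × Point (d + 1)) := {z | b < |z.2.1 0|} with hfar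
  -- The true sign depends on the whole sample. Freezing `τ` makes the indicators i.i.d. given the
  -- test point; a union bound over `τ = ±1` costs a factor `2`.
  set bad : ℝ → Set ((Fin n → Point (d + 1)) × Point (d + 1)) := fun τ =>
    {z | |z.2.1 0| ≤ b ∧ n * (b + 2 * η) + t ≤ unbeatenCount b η τ z.1 (z.2.1 0)} with hbad
  have hsub : {z : (Fin n → Point (d + 1)) × Point (d + 1) |
      z.2.2 ∈ jackknifePlusInterval ε α (tournament d b K c) z.1 z.2.1}
      ≤ᵐ[jointLaw (d + 1) n] (far ∪ (bad 1 ∪ bad (-1)) : Set _) := by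
    filter_upwards [ae_responses_eq_zero (d + 1) n] with z hz hcov
    by_contra hnot
    have hx : |z.2.1 0| ≤ b := by
      by_contra h
      exact hnot (Or.inl (not_le.1 h))
    have hcount : unbeatenCount b η (signProd z.1) z.1 (z.2.1 0) < n * (b + 2 * η) + t := by
      by_contra h
      refine hnot (Or.inr ?_)
      rcases signProd_eq_or z.1 with h1 | h1 <;> rw [h1] at h
      · exact Or.inl ⟨hx, not_lt.1 h⟩
      · exact Or.inr ⟨hx, not_lt.1 h⟩
    have hq := qPlus_lt_of_unbeatenCount_lt (α := α) hK hε hη hc hz.2 hx (by linarith)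
    have hle : (z.2.2 : EReal) ≤ _ := hcov.2
    rw [hz.1] at hle
    have := EReal.add_lt_add_right_coe hq ε
    rw [← EReal.coe_add, neg_add_cancel] at this
    exact absurd hle (not_le.2 this)
  have hfar_le : (jointLaw (d + 1) n).real far ≤ 1 - 2 * b := by
    have h1 : (jointLaw (d + 1) n).real far = centeredUniform.real (Set.Icc (-b) b)ᶜ := by
      have : far = Set.univ ×ˢ {x : Point (d + 1) | x.1 0 ∈ (Set.Icc (-b) b)ᶜ} := by
        ext z
        simp only [hfar, Set.mem_ofPred_eq, Set.mem_prod, Set.mem_univ, true_and,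
          Set.mem_compl_iff, Set.mem_Icc, ← abs_le, not_le]
      rw [this, measureReal_def, Measure.prod_prod, measure_univ, one_mul,
        diagDist_apply measurableSet_Icc.compl, measureReal_def]
    have h2 : centeredUniform.real (Set.Icc (-b) b) = 2 * b := by
      rw [measureReal_def, centeredUniform, Measure.restrict_apply measurableSet_Icc,
        Set.inter_eq_left.2 (Set.Icc_subset_Icc (by linarith) hb1), Real.volume_Icc,
        ENNReal.toReal_ofReal (by linarith)]
      ring
    rw [h1, probReal_compl_eq_one_sub measurableSet_Icc, h2]
  have hbad_le : ∀ τ : ℝ, τ = 1 ∨ τ = -1 →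
      (jointLaw (d + 1) n).real (bad τ) ≤ Real.exp (-(2 * t ^ 2 / n)) := by
    intro τ hτ
    have hmeas : MeasurableSet (bad τ) := by
      have h1 : Measurable fun z : (Fin n → Point (d + 1)) × Point (d + 1) => |z.2.1 0| := by
        fun_prop
      refine (fun hcount : Measurable fun z : (Fin n → Point (d + 1)) × Point (d + 1) =>
          unbeatenCount b η τ z.1 (z.2.1 0) =>
        (measurableSet_le h1 measurable_const).inter
          (measurableSet_le measurable_const hcount)) ?_
      refine Finset.measurable_fun_sum _ fun i _ => ?_
      have h2 : Measurable fun z : (Fin n → Point (d + 1)) × Point (d + 1) => (z.1 i).1 0 := by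
        fun_prop
      have h3 : Measurable fun z : (Fin n → Point (d + 1)) × Point (d + 1) => |(z.1 i).1 0| := by
        fun_prop
      refine Measurable.ite (p := fun z : (Fin n → Point (d + 1)) × Point (d + 1) =>
        (z.1 i).1 0 ∈ unbeaten b η τ |z.2.1 0|) ?_ measurable_const measurable_const
      exact (measurableSet_le h3 measurable_const).inter (measurableSet_le
        (((measurable_signOf.comp h2).const_mul τ).mul (h1.sub h3)) measurable_const)
    rw [measureReal_def]
    refine ENNReal.toReal_le_of_le_ofReal (Real.exp_pos _).le ?_
    have : SFinite (Measure.pi fun _ : Fin n => (diagDist (d + 1) : Measure (Point (d + 1)))) :=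
      instSFiniteOfSigmaFinite
    rw [jointLaw, Measure.prod_apply_symm hmeas]
    refine (lintegral_mono (g := fun _ => ENNReal.ofReal (Real.exp (-(2 * t ^ 2 / n))))
      fun x => ?_).trans (by simp)
    by_cases hx : |x.1 0| ≤ b
    · have hS : MeasurableSet {y : Point (d + 1) | y.1 0 ∈ unbeaten b η τ |x.1 0|} :=
        (show Measurable fun y : Point (d + 1) => y.1 0 by fun_prop)
          (measurableSet_unbeaten _ _ _ _)
      have hq : (diagDist (d + 1) : Measure (Point (d + 1))).real
          {y | y.1 0 ∈ unbeaten b η τ |x.1 0|} ≤ b + 2 * η := by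
        rw [measureReal_def, diagDist_apply (measurableSet_unbeaten _ _ _ _)]
        exact ENNReal.toReal_le_of_le_ofReal (by linarith)
          ((centeredUniform_le _).trans (volume_unbeaten_le hη0 hτ (abs_nonneg _) hx))
      have h := measureReal_card_ge_le _ hS hq n ht
      rw [measureReal_def, ← ENNReal.le_ofReal_iff_toReal_le (measure_ne_top _ _)
        (Real.exp_pos _).le] at h
      exact (measure_mono fun D hD => hD.2).trans h
    · have : (fun D : Fin n → Point (d + 1) => (D, x)) ⁻¹' bad τ = ∅ := by
        ext D
        simp [hbad, hx]
      simp [this]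
  have hle : coverage n (diagDist (d + 1)) (jackknifePlusInterval ε α (tournament d b K c)) ≤
      (jointLaw (d + 1) n).real (far ∪ (bad 1 ∪ bad (-1))) :=
    ENNReal.toReal_mono (measure_ne_top _ _) (measure_mono_ae hsub)
  have hu1 := measureReal_union_le (μ := jointLaw (d + 1) n) far (bad 1 ∪ bad (-1))
  have hu2 := measureReal_union_le (μ := jointLaw (d + 1) n) (bad 1) (bad (-1))
  have hb1 := hbad_le 1 (Or.inl rfl)
  have hb2 := hbad_le (-1) (Or.inr rfl)
  linarith

lemma coverage_le_one {d n : ℕ} (P : ProbabilityMeasure (Point d))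
    (C : (Fin n → Point d) → (Fin d → ℝ) → Set ℝ) : coverage n P C ≤ 1 :=
  measureReal_le_one

lemma exists_coverage_jackknifePlus_le (d : ℕ) {n : ℕ} (hn : 2 ≤ n) {α ε : ℝ}
    (hα : α ≤ 1 / 2) (hε : 0 ≤ ε) :
    ∃ A : RegressionAlgorithm (d + 1), A.IsMeasurable ∧
      coverage n (diagDist (d + 1)) (jackknifePlusInterval ε α A) ≤
        1 - 2 * α + 6 * Real.sqrt (Real.log n / n) := by
  set L := Real.sqrt (Real.log n / n) with hL
  have hL0 : 0 ≤ L := Real.sqrt_nonneg _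
  have hn0 : (0 : ℝ) < n := by positivity
  -- `L` pays for the deviation `t = n * L`, and `3 / n` for the margin `2 * η = 1 / n` and the
  -- rounding in the quantile index.
  set b := α - L - 3 / n with hb
  refine ⟨tournament d b (2 * n * (ε + 1)) (ε + 1), tournament_isMeasurable _ _ _ _, ?_⟩
  by_cases htriv : 1 ≤ 1 - 2 * α + 6 * L
  · exact (coverage_le_one _ _).trans htriv
  have hLsq : L ^ 2 = Real.log n / n := Real.sq_sqrt (by positivity)
  -- For `n = 2` the bound exceeds `1`; from `n = 3` on, `log n ≥ 1`.
  have hn3 : 3 ≤ n := by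
    by_contra h
    obtain rfl : n = 2 := by omega
    refine htriv ?_
    have h1 : (1 : ℝ) / 6 ≤ L := by
      refine Real.le_sqrt_of_sq_le ?_
      have := Real.log_two_gt_d9
      push_cast
      linarith
    linarith
  have hn3' : (3 : ℝ) ≤ n := by exact_mod_cast hn3
  have hlog : 1 ≤ Real.log n := by
    rw [Real.le_log_iff_exp_le hn0]
    have := Real.exp_one_lt_d9
    linarith
  -- The loss beyond `2 * L`: `6 / n` from `2 * b`, and `2 / n ^ 2` from the two Hoeffding tails.
  have hsmall : 6 / (n : ℝ) + 2 * (1 / (n : ℝ) ^ 2) ≤ 4 * L := by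
    have h1 : 5 / (3 * (n : ℝ)) ≤ L := by
      refine Real.le_sqrt_of_sq_le ?_
      rw [div_pow, div_le_div_iff₀ (by positivity) hn0]
      nlinarith [mul_le_mul_of_nonneg_right hlog (sq_nonneg (n : ℝ))]
    have h2 : 2 * (1 / (n : ℝ) ^ 2) ≤ 2 / 3 / n := by
      rw [div_div, mul_one_div, div_le_div_iff₀ (by positivity) (by positivity)]
      nlinarith
    have h3 : 6 / (n : ℝ) + 2 / 3 / n = 4 * (5 / (3 * n)) := by
      field_simp
      norm_num
    linarith
  have hexp : Real.exp (-(2 * (n * L) ^ 2 / n)) = 1 / (n : ℝ) ^ 2 := by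
    have : 2 * (n * L) ^ 2 / n = Real.log ((n : ℝ) ^ 2) := by
      rw [mul_pow, hLsq, Real.log_pow]
      field_simp
      norm_num
    rw [this, Real.exp_neg, Real.exp_log (by positivity), one_div]
  have h6 : 2 * (3 / (n : ℝ)) = 6 / n := by ring
  rcases lt_or_ge b 0 with hneg | hpos
  · refine absurd ?_ htriv
    have : 0 ≤ 1 / (n : ℝ) ^ 2 := by positivity
    linarith
  · have h3n : 0 ≤ 3 / (n : ℝ) := by positivity
    refine (coverage_tournament_le (t := n * L) (η := 1 / (2 * n)) hpos (by linarith)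
      (by positivity) hε (by positivity) ?_ (by linarith) (by positivity) ?_).trans ?_
    · have : 2 * (n : ℝ) * (ε + 1) * (1 / (2 * n)) = ε + 1 := by field_simp
      linarith
    · have hceil := Nat.ceil_lt_add_one (a := (1 - α) * ((n : ℝ) + 1))
        (mul_nonneg (by linarith) (by positivity))
      have : (n : ℝ) * (b + 2 * (1 / (2 * n))) = n * α - n * L - 2 := by
        rw [hb]
        field_simp
        ring
      rw [this]
      linarith
    · rw [hexp]
      linarith

end Jackknife

end

theorem theorem2 (n : ℕ) (hn : 2 ≤ n) (α : ℝ) (hα : 1 / ((n : ℝ) + 1) ≤ α) (hα1 : α ≤ 1)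
    (d : ℕ) (hd : 1 ≤ d) (ε : ℝ) (hε : 0 ≤ ε) :
    (∃ (P : ProbabilityMeasure (Jackknife.Point d)) (A : Jackknife.RegressionAlgorithm d),
      A.IsMeasurable ∧
      Jackknife.coverage n P (Jackknife.naiveInterval ε α A) = 0 ∧
      Jackknife.coverage n P (Jackknife.jackknifeInterval ε α A) = 0) ∧
    (α ≤ 1 / 2 →
      ∃ (P : ProbabilityMeasure (Jackknife.Point d)) (A : Jackknife.RegressionAlgorithm d),
        A.IsMeasurable ∧
        Jackknife.coverage n P (Jackknife.jackknifePlusInterval ε α A) ≤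
          1 - 2 * α + 6 * Real.sqrt (Real.log (n : ℝ) / (n : ℝ))) := by
  obtain ⟨d, rfl⟩ : ∃ e, d = e + 1 := ⟨d - 1, by omega⟩
  refine ⟨⟨Jackknife.diagDist (d + 1), Jackknife.overfit d n (ε + 1),
    Jackknife.overfit_isMeasurable _ _ _, Jackknife.coverage_overfit (by omega) hα ε⟩, ?_⟩
  intro hα2
  exact ⟨_, Jackknife.exists_coverage_jackknifePlus_le d hn hα2 hε⟩
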